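/- For $\Omega_{10}>0$ put $N_{\rm cr}=\Omega_{10}/2$ and, for $N>0$, consider the reduced system $$\dot\alpha=\Omega_{10}\beta+2\alpha^2\beta,\qquad \dot\beta=(2N-\Omega_{10})\alpha-4\alpha^3-2\alpha\beta^2, \tag{1}$$ with Hamiltonian $H_{\rm DW}(\alpha,\beta)=\frac{\Omega_{10}}2\beta^2+\frac{\Omega_{10}-2N}2\alpha^2+\alpha^4+\alpha^2\beta^2$; for $N>N_{\rm cr}$ the separatrix through the saddle $(0,0)$ is $\{H_{\rm DW}=0\}$. With $A=\sqrt{N-\alpha^2-\beta^2}$, solutions of (1) with $\alpha^2+\beta^2<N$ give solutions $\tilde\chi=(\alpha,\beta,A)$ of $$\dot\alpha=(\Omega_{10}+2\alpha^2)\beta,\qquad \dot\beta=-(\Omega_{10}+2\alpha^2-2A^2)\alpha,\qquad \dot A=-2\alpha\beta A. \tag{2}$$ A fundamental matrix solution about $\tilde\chi$ is a $3\times3$ matrix function $M(t)$, invertible for every $t$, with $\dot M(t)=B(t)M(t)$, where $B(t)$ is the Jacobian matrix of the right-hand side of (2) at $\tilde\chi(t)$; $\|\cdot\|$ is the Euclidean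 operator norm. **Lemma 2.2.** Let $\kappa>1$, $K>0$ and $c_0>0$. There is a constant $C>0$, depending only on $\kappa,K,c_0$, such that for every $\gamma\in(7/9,1)$ there is $\sigma_0>0$ with the following property. Let $0<\sigma<\sigma_0$, $N_{\rm cr}=\sigma^\gamma$, $0<|N-N_{\rm cr}|\le\sigma$ and $\alpha_0>0$, and suppose that one of the following holds: * $N>N_{\rm cr}$ and $\kappa(N-N_{\rm cr})\le\alpha_0^2\le K\sigma$ (Josephson tunneling orbits, outside the separatrix and away from it); or * $N<N_{\rm cr}$ and $\alpha_0^2\le K\sigma^{1+\delta}$ for some $\delta\ge0$ (beating and nonlinear beating orbits). Then the solution $(\tilde\alpha,\tilde\beta)$ of (1) with $(\tilde\alpha,\tilde\beta)(0)=(\alpha_0,0)$ exists for all time and is periodic with a least positive period $T$; $\tilde\alpha$ takes both signs; $\tilde\alpha^2+\tilde\beta^2<N$ for all $t$; $\tilde A=\sqrt{N-\tilde\alpha^2-\tilde\beta^2}$ is $T$-periodic, and $(\tilde\alpha,\tilde\beta,\tilde A)$ solves (2). If $N>N_{\rm cr}$, then $H_{\rm DW}(\tilde\alpha,\tilde\beta)>0$.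 For all $t$, $$|\tilde A(t)|^2\le C\sigma^\gamma,\qquad |\tilde\alpha(t)|^2+|\tilde\beta(t)|^2\le\begin{cases}C\sigma,&N>N_{\rm cr},\\ C\sigma^{1+\delta},&N<N_{\rm cr}.\end{cases}$$ Moreover, $$\text{(H1)}\quad T\le C\,\bigl(|N_{\rm cr}-N|\,N_{\rm cr}\bigr)^{-1/2},$$ a fundamental matrix solution about $(\tilde\alpha,\tilde\beta,\tilde A)$ with $M(0)=I$ exists, and every fundamental matrix solution $M$ about this orbit satisfies $$\text{(H2)}\quad \|M(t)M(s)^{-1}\|\le C\left(\frac{N+N_{\rm cr}}{|N-N_{\rm cr}|}\right)^{1/2}\qquad\text{for } 0<s,t<T.$$ If in addition $|N-N_{\rm cr}|\ge c_0\sigma$, then also $T\le C\sigma^{-(1+\gamma)/2}$ and $\|M(t)M(s)^{-1}\|\le C\sigma^{(\gamma-1)/2}$ for $0<s,t<T$. Thus these orbits satisfy the hypotheses (H1) and (H2) of Theorem 2.1. -/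

import Mathlib

open scoped Matrix.Norms.L2Operator

noncomputable section

namespace DoubleWell

/-- The symmetry breaking threshold `N_cr = Ω₁₀ / 2` of the finite dimensional model. -/
def Ncr (Ω : ℝ) : ℝ := Ω / 2

/-- The Hamiltonian `H_DW(α, β)`, where the coefficient of `α² / 2` is `Ω₁₀ - 2 N`. For
`N > N_cr` the separatrix through the saddle `(0, 0)` is the level set `H_DW = 0`. -/
def hamDW (Ω N a b : ℝ) : ℝ :=
  Ω / 2 * b ^ 2 + (Ω - 2 * N) / 2 * a ^ 2 + a ^ 4 + a ^ 2 * b ^ 2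

/-- `(α, β)` is a global solution of the planar reduced system
`α' = Ω₁₀ β + 2 α² β`, `β' = (2 N - Ω₁₀) α - 4 α³ - 2 α β²`. -/
structure IsPlanarSolution (Ω N : ℝ) (α β : ℝ → ℝ) : Prop where
  deriv_α : ∀ t, HasDerivAt α (Ω * β t + 2 * α t ^ 2 * β t) t
  deriv_β : ∀ t, HasDerivAt β
    ((2 * N - Ω) * α t + (-4 * α t ^ 3 - 2 * α t * β t ^ 2)) t

/-- The planar system is Hamilton's system `α' = ∂H/∂β`, `β' = -∂H/∂α`. -/
theorem hamDW_hasDerivAt (Ω N a b : ℝ) :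
    HasDerivAt (fun y => hamDW Ω N a y) (Ω * b + 2 * a ^ 2 * b) b ∧
    HasDerivAt (fun x => hamDW Ω N x b)
      (-((2 * N - Ω) * a + (-4 * a ^ 3 - 2 * a * b ^ 2))) a := by
  constructor
  · have h := (((hasDerivAt_pow 2 b).const_mul (Ω / 2)).add_const
      ((Ω - 2 * N) / 2 * a ^ 2 + a ^ 4)).add ((hasDerivAt_pow 2 b).const_mul (a ^ 2))
    refine (h.congr_deriv ?_).congr_of_eventuallyEq (.of_forall fun y => ?_)
    · norm_num; ring
    · simp only [hamDW, Pi.add_apply]; ring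
  · have h := ((((hasDerivAt_pow 2 a).const_mul ((Ω - 2 * N) / 2)).const_add
      (Ω / 2 * b ^ 2)).add (hasDerivAt_pow 4 a)).add ((hasDerivAt_pow 2 a).mul_const (b ^ 2))
    refine (h.congr_deriv ?_).congr_of_eventuallyEq (.of_forall fun y => ?_)
    · norm_num; ring
    · simp only [hamDW, Pi.add_apply]

/-- The amplitude `A ≥ 0` determined by the conservation law `N = A² + α² + β²`
(meaningful when `α² + β² ≤ N`). -/
def amp (N : ℝ) (α β : ℝ → ℝ) (t : ℝ) : ℝ := Real.sqrt (N - α t ^ 2 - β t ^ 2)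

/-- The vector field of the three dimensional system
`α' = (Ω₁₀ + 2 α²) β`, `β' = -(Ω₁₀ + 2 α² - 2 A²) α`, `A' = -2 α β A`,
in the coordinates `(α, β, A)`. -/
def field (Ω : ℝ) (χ : Fin 3 → ℝ) : Fin 3 → ℝ :=
  ![(Ω + 2 * χ 0 ^ 2) * χ 1,
    -(Ω + 2 * χ 0 ^ 2 - 2 * χ 2 ^ 2) * χ 0,
    -2 * χ 0 * χ 1 * χ 2]

/-- The point `(α(t), β(t), A(t))` of the curve in the three dimensional phase space. -/
def orbit (N : ℝ) (α β : ℝ → ℝ) (t : ℝ) : Fin 3 → ℝ := ![α t, β t, amp N α β t]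

/-- The Jacobian matrix of `field Ω` at `χ = (α, β, A)`. -/
def jac (Ω : ℝ) (χ : Fin 3 → ℝ) : Matrix (Fin 3) (Fin 3) ℝ :=
  !![4 * χ 0 * χ 1, Ω + 2 * χ 0 ^ 2, 0;
     -(Ω + 6 * χ 0 ^ 2 - 2 * χ 2 ^ 2), 0, 4 * χ 0 * χ 2;
     -2 * χ 1 * χ 2, -2 * χ 0 * χ 2, -2 * χ 0 * χ 1]

/-- `jac` is the derivative of `field`: the derivative at `χ` in the direction `v`
is `jac Ω χ *ᵥ v`. -/
theorem field_hasDerivAt (Ω : ℝ) (χ v : Fin 3 → ℝ) :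
    HasDerivAt (fun h : ℝ => field Ω (χ + h • v)) ((jac Ω χ).mulVec v) 0 := by
  have l : ∀ i : Fin 3, HasDerivAt (fun h : ℝ => χ i + h * v i) (v i) 0 := fun i => by
    simpa using ((hasDerivAt_id (0 : ℝ)).mul_const (v i)).const_add (χ i)
  rw [hasDerivAt_pi]
  intro i
  fin_cases i
  · have h := ((((l 0).pow 2).const_mul 2).const_add Ω).mul (l 1)
    refine (h.congr_deriv ?_).congr_of_eventuallyEq (.of_forall fun y => ?_)
    · simp [jac, Matrix.mulVec, dotProduct, Fin.sum_univ_three]; ring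
    · simp [field]
  · have h := ((((((l 0).pow 2).const_mul 2).const_add Ω).sub
      (((l 2).pow 2).const_mul 2)).neg).mul (l 0)
    refine (h.congr_deriv ?_).congr_of_eventuallyEq (.of_forall fun y => ?_)
    · simp [jac, Matrix.mulVec, dotProduct, Fin.sum_univ_three]; ring
    · simp [field]
  · have h := (((l 0).const_mul (-2)).mul (l 1)).mul (l 2)
    refine (h.congr_deriv ?_).congr_of_eventuallyEq (.of_forall fun y => ?_)
    · simp [jac, Matrix.mulVec, dotProduct, Fin.sum_univ_three]; ring
    · simp [field]

/-- `(α, β)` is a solution of the planar system that starts at `(α₀, 0)` and is periodic with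
least positive period `T`, that stays in the open disc `α² + β² < N`, that takes both signs
of `α`, and for which `(α, β, A)`, with `A = √(N - α² - β²)`, is a `T`-periodic solution of the
three dimensional system. -/
structure IsPeriodicOrbit (Ω N α₀ : ℝ) (α β : ℝ → ℝ) (T : ℝ) : Prop where
  solution : IsPlanarSolution Ω N α β
  init_α : α 0 = α₀
  init_β : β 0 = 0
  period : IsLeast {S : ℝ | 0 < S ∧ Function.Periodic (fun t => (α t, β t)) S} T
  in_disc : ∀ t, α t ^ 2 + β t ^ 2 < N
  sign_change : (∃ t, 0 < α t) ∧ (∃ t, α t < 0)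
  solution_field : ∀ t, HasDerivAt (orbit N α β) (field Ω (orbit N α β t)) t
  periodic_amp : Function.Periodic (amp N α β) T

/-- `M` is a fundamental matrix solution of the linearized system `v' = jac Ω χ(t) v` about the
orbit `χ = (α, β, A)`: `M' = jac Ω χ(t) M` (entry by entry) and `M(t)` is invertible. -/
structure IsFundamentalMatrix (Ω N : ℝ) (α β : ℝ → ℝ)
    (M : ℝ → Matrix (Fin 3) (Fin 3) ℝ) : Prop where
  deriv : ∀ t i j, HasDerivAt (fun s => M s i j) ((jac Ω (orbit N α β t) * M t) i j) t
  invertible : ∀ t, IsUnit (M t).det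

/-- There is a fundamental matrix with `M(0) = I`, and every fundamental matrix satisfies
`‖M(t) M(s)⁻¹‖ ≤ R` for `0 < s, t < T`, in the Euclidean operator norm. -/
def FundamentalBound (Ω N : ℝ) (α β : ℝ → ℝ) (T R : ℝ) : Prop :=
  (∃ M, IsFundamentalMatrix Ω N α β M ∧ M 0 = 1) ∧
  ∀ M, IsFundamentalMatrix Ω N α β M →
    ∀ s t, 0 < s → s < T → 0 < t → t < T → ‖M t * (M s)⁻¹‖ ≤ R

/-- The bounds on the period and on the fundamental matrix, with constant `C`. They are given
in terms of `N` and `N_cr`, and also in terms of powers of `σ` when `|N - N_cr|` is at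
least `c₀ σ`. -/
structure PeriodAndMatrixBounds (C c₀ γ σ Ω N : ℝ) (α β : ℝ → ℝ) (T : ℝ) : Prop where
  period : T ≤ C * (|Ncr Ω - N| * Ncr Ω) ^ (-(1 / 2) : ℝ)
  matrix : FundamentalBound Ω N α β T (C * ((N + Ncr Ω) / |N - Ncr Ω|) ^ (1 / 2 : ℝ))
  period_σ : c₀ * σ ≤ |N - Ncr Ω| → T ≤ C * σ ^ (-((1 + γ) / 2))
  matrix_σ : c₀ * σ ≤ |N - Ncr Ω| → FundamentalBound Ω N α β T (C * σ ^ ((γ - 1) / 2))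

end DoubleWell

end

/-! Write `Ω = 2n`, `N = n - s` and `α₀ = a`. Energy conservation reads `(n + α²) β² = (a² - α²)(a²
+ s + α²)`, so `α = a cos φ` parametrizes the whole level curve without singular turning points, and
the flow becomes `φ' = 2 √(a² + s + α²) √(n + α²)`. Put `μ² = |s| + a²`. Away from the separatrix
`a² + s ≥ c μ²` with `c` depending only on `κ`, so `φ` advances at a rate at least `2 √(c n) μ`; one
turn of `2π` is one period, hence `√n μ T ≤ π / √c`. On the separatrix `a² + s = 0`, and the phase
would stall at the saddle.

On the orbit `β` is smaller than `α` by a factor of order `μ / √n`. Conjugating the linearization by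
`diag (μ / √n, 1, 1)` makes all its entries `O(√n μ)`, so Grönwall over one period costs a constant
factor (`norm_scaled_jac_le`, `IsPeriodicOrbit.fundamentalBound`). Undoing the conjugation costs `√n
/ μ ≤ √(n / |s|)`, which is the rate in (H2). -/

namespace DoubleWell

open MeasureTheory Set Filter
open scoped Interval

/-! ### Linear equations in a Banach algebra: Picard series and Grönwall bounds. -/

section LinearODE

variable {A : Type*} [NormedRing A] [NormedAlgebra ℝ A]

/-- The terms of the Picard series of `X' = B X`, `X 0 = 1`. -/
noncomputable def picardTerm (B : ℝ → A) : ℕ → ℝ → A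
  | 0 => fun _ => 1
  | k + 1 => fun t => ∫ x in (0 : ℝ)..t, B x * picardTerm B k x

/-- The derivatives of the terms of the Picard series. -/
noncomputable def picardTermDeriv (B : ℝ → A) : ℕ → ℝ → A
  | 0 => fun _ => 0
  | k + 1 => fun t => B t * picardTerm B k t

theorem picardTerm_continuous_and_hasDerivAt [CompleteSpace A] {B : ℝ → A} (hB : Continuous B)
    (k : ℕ) : Continuous (picardTerm B k) ∧
      ∀ t, HasDerivAt (picardTerm B k) (picardTermDeriv B k t) t := by
  induction k with
  | zero => exact ⟨continuous_const, fun t => hasDerivAt_const t _⟩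
  | succ k ih =>
    have h : ∀ t, HasDerivAt (picardTerm B (k + 1)) (picardTermDeriv B (k + 1) t) t := fun t =>
      intervalIntegral.integral_hasDerivAt_right
        ((hB.mul ih.1).intervalIntegrable _ _)
        ((hB.mul ih.1).stronglyMeasurableAtFilter _ _) (hB.mul ih.1).continuousAt
    exact ⟨continuous_iff_continuousAt.2 fun t => (h t).continuousAt, h⟩

/-- The factorial from the iterated integrals makes the series converge for all time, not only for
short times. -/
theorem norm_picardTerm_le [CompleteSpace A] {B : ℝ → A} (hB : Continuous B) {L : ℝ}
    (hL : ∀ t, ‖B t‖ ≤ L) (k : ℕ) (t : ℝ) :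
    ‖picardTerm B k t‖ ≤ ‖(1 : A)‖ * ((L * |t|) ^ k / k.factorial) := by
  have hL0 : 0 ≤ L := (norm_nonneg _).trans (hL 0)
  induction k generalizing t with
  | zero => simp [picardTerm]
  | succ k ih =>
    have hc : Continuous fun x => ‖(1 : A)‖ * (L ^ (k + 1) / k.factorial) * |x - 0| ^ k := by
      fun_prop
    calc ‖picardTerm B (k + 1) t‖ ≤ ∫ x in Ι (0 : ℝ) t, ‖B x * picardTerm B k x‖ :=
          intervalIntegral.norm_integral_le_integral_norm_uIoc
      _ ≤ ∫ x in Ι (0 : ℝ) t, ‖(1 : A)‖ * (L ^ (k + 1) / k.factorial) * |x - 0| ^ k := by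
          refine integral_mono ?_ ?_ fun x => ?_
          · exact ((hB.mul (picardTerm_continuous_and_hasDerivAt hB k).1).norm.intervalIntegrable
              0 t).def'
          · exact (hc.intervalIntegrable 0 t).def'
          · refine (norm_mul_le _ _).trans ((mul_le_mul (hL x) (ih x) (norm_nonneg _) hL0).trans
              (le_of_eq ?_))
            rw [sub_zero, mul_pow, pow_succ]; ring
      _ = ‖(1 : A)‖ * ((L * |t|) ^ (k + 1) / (k + 1).factorial) := by
          rw [integral_const_mul, integral_pow_abs_sub_uIoc, Nat.factorial_succ, sub_zero, mul_pow]
          push_cast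
          field_simp

/-- A linear equation with a bounded continuous coefficient has a global fundamental solution. -/
theorem exists_linear_solution [CompleteSpace A] {B : ℝ → A} (hB : Continuous B) {L : ℝ}
    (hL : ∀ t, ‖B t‖ ≤ L) :
    ∃ X : ℝ → A, X 0 = 1 ∧ ∀ t, HasDerivAt X (B t * X t) t := by
  have hL0 : 0 ≤ L := (norm_nonneg _).trans (hL 0)
  have hsum : ∀ R : ℝ, Summable fun k : ℕ => ‖(1 : A)‖ * ((L * R) ^ k / k.factorial) := fun R =>
    (Real.summable_pow_div_factorial _).mul_left _
  have hterm : ∀ t, Summable fun k => picardTerm B k t := fun t =>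
    .of_norm_bounded (hsum |t|) fun k => norm_picardTerm_le hB hL k t
  have h0 : ∀ k, picardTerm B (k + 1) 0 = 0 := fun k => intervalIntegral.integral_same
  refine ⟨fun t => ∑' k, picardTerm B k t, ?_, fun t => ?_⟩
  · change ∑' k, picardTerm B k 0 = 1
    rw [tsum_eq_single 0]
    · rfl
    · rintro (_ | k) hk
      · exact absurd rfl hk
      · exact h0 k
  · have key := hasDerivAt_tsum_of_isPreconnected (𝕜 := ℝ) (g := picardTerm B)
      (g' := picardTermDeriv B) (t := Metric.ball 0 (|t| + 1)) (y := t) (y₀ := t)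
      (u := fun k => Nat.casesOn k 0
        fun k => L * (‖(1 : A)‖ * ((L * (|t| + 1)) ^ k / k.factorial)))
      ?_ Metric.isOpen_ball (convex_ball _ _).isPreconnected
      (fun k y _ => (picardTerm_continuous_and_hasDerivAt hB k).2 y) ?_ ?_ (hterm t) ?_
    · have hd : Summable fun k => picardTermDeriv B k t :=
        (summable_nat_add_iff 1).1 ((hterm t).mul_left (B t))
      rw [hd.tsum_eq_zero_add] at key
      have e : (∑' k, picardTermDeriv B (k + 1) t) = B t * ∑' k, picardTerm B k t :=
        (hterm t).tsum_mul_left (B t)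
      rw [e] at key
      simpa [picardTermDeriv] using key
    · exact (summable_nat_add_iff 1).1 ((hsum (|t| + 1)).mul_left L)
    · rintro (_ | k) y hy
      · simp [picardTermDeriv]
      · have hy' : |y| ≤ |t| + 1 := by
          rw [Metric.mem_ball, dist_zero_right, Real.norm_eq_abs] at hy
          exact hy.le
        refine (norm_mul_le _ _).trans (mul_le_mul (hL y)
          ((norm_picardTerm_le hB hL k y).trans ?_) (norm_nonneg _) hL0)
        gcongr
    · simp
    · simp

/-- Grönwall's inequality for a linear equation, forwards in time. -/
theorem norm_le_exp_of_le {X B : ℝ → A} {L s t : ℝ} (hst : s ≤ t)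
    (hX : ∀ x, HasDerivAt X (B x * X x) x) (hL : ∀ x, ‖B x‖ ≤ L) :
    ‖X t‖ ≤ ‖X s‖ * Real.exp (L * (t - s)) := by
  have h := norm_le_gronwallBound_of_norm_deriv_right_le (f := X) (f' := fun x => B x * X x)
    (δ := ‖X s‖) (K := L) (ε := 0) (a := s) (b := t)
    (fun x _ => (hX x).continuousAt.continuousWithinAt) (fun x _ => (hX x).hasDerivWithinAt)
    le_rfl (fun x _ => by
      rw [add_zero]
      exact (norm_mul_le _ _).trans (mul_le_mul_of_nonneg_right (hL x) (norm_nonneg _)))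
    t ⟨hst, le_rfl⟩
  rwa [gronwallBound_ε0] at h

/-- Grönwall's inequality for a linear equation, in both directions of time. -/
theorem norm_le_exp {X B : ℝ → A} {L : ℝ} (s t : ℝ)
    (hX : ∀ x, HasDerivAt X (B x * X x) x) (hL : ∀ x, ‖B x‖ ≤ L) :
    ‖X t‖ ≤ ‖X s‖ * Real.exp (L * |t - s|) := by
  rcases le_total s t with h | h
  · rw [abs_of_nonneg (sub_nonneg.2 h)]
    exact norm_le_exp_of_le h hX hL
  · have hd : ∀ x, HasDerivAt (fun x => X (-x)) (-B (-x) * X (-x)) x := fun x => by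
      simpa [Function.comp_def] using (hX (-x)).scomp x (hasDerivAt_neg x)
    have := norm_le_exp_of_le (neg_le_neg h) hd (B := fun x => -B (-x)) (L := L)
      (fun x => by rw [norm_neg]; exact hL _)
    rw [abs_of_nonpos (sub_nonpos.2 h)]
    simpa [neg_add_eq_sub, sub_eq_add_neg, add_comm] using this

end LinearODE

/-! ### Matrix norms, entrywise derivatives and fundamental matrices. -/

section Matrices

variable {m : Type*} [Fintype m] [DecidableEq m]

/-- The C⋆-identity reduces this to the norm of a diagonal matrix. -/
theorem l2_opNorm_single (i j : m) (a : ℝ) : ‖Matrix.single i j a‖ = |a| := by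
  have h := Matrix.l2_opNorm_conjTranspose_mul_self (Matrix.single i j a)
  have e : (Matrix.single i j a).conjTranspose * Matrix.single i j a
      = Matrix.diagonal (Pi.single j (a * a)) := by
    rw [Matrix.conjTranspose_single, Matrix.single_mul_single_same, Matrix.diagonal_single]
    simp
  rw [e, Matrix.l2_opNorm_diagonal, Pi.norm_single, Real.norm_eq_abs, abs_mul] at h
  exact ((mul_self_inj_of_nonneg (abs_nonneg a) (norm_nonneg _)).1 h).symm

theorem l2_opNorm_le_sum (M : Matrix m m ℝ) : ‖M‖ ≤ ∑ i, ∑ j, |M i j| := by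
  conv_lhs => rw [Matrix.matrix_eq_sum_single M]
  refine (norm_sum_le _ _).trans (Finset.sum_le_sum fun i _ => (norm_sum_le _ _).trans
    (Finset.sum_le_sum fun j _ => (l2_opNorm_single i j _).le))

theorem hasDerivAt_matrix_iff {M : ℝ → Matrix m m ℝ} {M' : Matrix m m ℝ} {t : ℝ} :
    HasDerivAt M M' t ↔ ∀ i j, HasDerivAt (fun s => M s i j) (M' i j) t := by
  constructor
  · intro h i j
    exact ((Matrix.entryLinearMap ℝ ℝ i j).toContinuousLinearMap.hasFDerivAt).comp_hasDerivAt t h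
  · intro h
    have key : HasDerivAt (fun s => ∑ i, ∑ j, (M s i j) • Matrix.single i j (1 : ℝ))
        (∑ i, ∑ j, (M' i j) • Matrix.single i j (1 : ℝ)) t :=
      HasDerivAt.fun_sum fun i _ => HasDerivAt.fun_sum fun j _ => (h i j).smul_const _
    have e : ∀ M : Matrix m m ℝ, ∑ i, ∑ j, (M i j) • Matrix.single i j (1 : ℝ) = M := fun M => by
      conv_rhs => rw [Matrix.matrix_eq_sum_single M]
      simp [Matrix.smul_single]
    simpa only [e] using key

theorem hasDerivAt_transpose {M : ℝ → Matrix m m ℝ} {M' : Matrix m m ℝ} {t : ℝ}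
    (h : HasDerivAt M M' t) : HasDerivAt (fun s => (M s).transpose) M'.transpose t :=
  hasDerivAt_matrix_iff.2 fun i j => hasDerivAt_matrix_iff.1 h j i

/-- Existence of a global fundamental matrix for a bounded continuous coefficient matrix. -/
theorem exists_fundamental_matrix {B : ℝ → Matrix m m ℝ} (hB : Continuous B) {L : ℝ}
    (hL : ∀ t, ‖B t‖ ≤ L) :
    ∃ M : ℝ → Matrix m m ℝ, M 0 = 1 ∧ (∀ t, HasDerivAt M (B t * M t) t) ∧
      ∀ t, IsUnit (M t).det := by
  obtain ⟨M, hM0, hM⟩ := exists_linear_solution hB hL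
  -- `Y` solves the adjoint equation, so `Yᵀ M` is constant and equal to `1`: this is the
  -- invertibility of `M`.
  obtain ⟨Y, hY0, hY⟩ := exists_linear_solution (B := fun t => -(B t).transpose) (L := L)
    hB.matrix_transpose.neg fun t => by
      have := Matrix.l2_opNorm_conjTranspose (B t)
      rw [Matrix.conjTranspose_eq_transpose_of_trivial] at this
      rw [norm_neg, this]
      exact hL t
  refine ⟨M, hM0, hM, fun t => ?_⟩
  have hd : ∀ t, HasDerivAt (fun t => (Y t).transpose * M t) 0 t := fun t => by
    refine ((hasDerivAt_transpose (hY t)).mul (hM t)).congr_deriv ?_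
    simp [Matrix.transpose_mul, Matrix.mul_assoc]
  have hc := is_const_of_deriv_eq_zero (fun t => (hd t).differentiableAt) (fun t => (hd t).deriv) t 0
  simp only [hM0, hY0, Matrix.transpose_one, Matrix.mul_one] at hc
  exact (Matrix.isUnit_iff_isUnit_det _).1 (IsUnit.of_mul_eq_one_right _ hc)

end Matrices

/-! ### Separation of variables for the phase equation. -/

/-- A scalar autonomous equation with a positive continuous periodic right hand side. -/
theorem exists_phase {F : ℝ → ℝ} (hF : Continuous F) {m p : ℝ} (hm : 0 < m) (hp : 0 < p)
    (hmF : ∀ x, m ≤ F x) (hper : Function.Periodic F p) :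
    ∃ (φ : ℝ → ℝ) (T : ℝ), φ 0 = 0 ∧ StrictMono φ ∧ Function.Surjective φ ∧
      (∀ t, HasDerivAt φ (F (φ t)) t) ∧ 0 < T ∧ T ≤ p / m ∧ ∀ t, φ (t + T) = φ t + p := by
  have hpos : ∀ x, 0 < F x := fun x => hm.trans_le (hmF x)
  have hg : Continuous fun x => (F x)⁻¹ := hF.inv₀ fun x => (hpos x).ne'
  have hgper : Function.Periodic (fun x => (F x)⁻¹) p := fun x => by simp only [hper x]
  have hint : ∀ a b, IntervalIntegrable (fun x => (F x)⁻¹) volume a b := hg.intervalIntegrable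
  -- `τ` is time as a function of phase. It is inverted to give the solution, and `T = τ p` is the
  -- time of one turn.
  set τ : ℝ → ℝ := fun x => ∫ y in (0 : ℝ)..x, (F y)⁻¹ with hτ
  have hτd : ∀ x, HasDerivAt τ (F x)⁻¹ x := fun x =>
    intervalIntegral.integral_hasDerivAt_right (hint _ _) (hg.stronglyMeasurableAtFilter _ _)
      hg.continuousAt
  have hmono : StrictMono τ := strictMono_of_deriv_pos fun x => by
    rw [(hτd x).deriv]; exact inv_pos.2 (hpos x)
  have hsurj : Function.Surjective τ :=
    Continuous.surjective (continuous_iff_continuousAt.2 fun x => (hτd x).continuousAt)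
      (hgper.tendsto_atTop_intervalIntegral_of_pos' (hint 0 p) (fun x => inv_pos.2 (hpos x)) hp)
      (hgper.tendsto_atBot_intervalIntegral_of_pos' (hint 0 p) (fun x => inv_pos.2 (hpos x)) hp)
  let e := hmono.orderIsoOfSurjective τ hsurj
  have he : ∀ x, τ (e.symm x) = x := e.apply_symm_apply
  have hadd : ∀ x, τ (x + p) = τ x + τ p := fun x => by
    have h1 := hgper.intervalIntegral_add_eq x 0
    rw [zero_add] at h1
    rw [hτ]
    simp only
    rw [← h1, intervalIntegral.integral_add_adjacent_intervals (hint _ _) (hint _ _)]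
  have hτ0 : τ 0 = 0 := intervalIntegral.integral_same
  refine ⟨e.symm, τ p, ?_, e.symm.strictMono, e.symm.surjective, fun t => ?_, ?_, ?_, fun t => ?_⟩
  · exact hmono.injective (by rw [he, hτ0])
  · have := HasDerivAt.of_local_left_inverse (f := τ) (g := e.symm) (a := t)
      e.symm.continuous.continuousAt (hτd _) (inv_pos.2 (hpos _)).ne' (.of_forall he)
    rwa [inv_inv] at this
  · rw [← hτ0]; exact hmono hp
  · have h1 : τ p ≤ ∫ _ in (0 : ℝ)..p, m⁻¹ :=
      intervalIntegral.integral_mono_on hp.le (hint _ _) (by simp)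
        fun x _ => inv_anti₀ hm (hmF x)
    simpa [div_eq_mul_inv] using h1
  · exact hmono.injective (by rw [he, hadd, he])

end DoubleWell

/-! ### Periodic orbits through the phase parametrization. -/

namespace DoubleWell

open Real

/-- A planar solution inside the disc gives a solution of the three dimensional system. -/
theorem IsPlanarSolution.hasDerivAt_orbit {Ω N : ℝ} {α β : ℝ → ℝ}
    (h : IsPlanarSolution Ω N α β) (hdisc : ∀ t, α t ^ 2 + β t ^ 2 < N) (t : ℝ) :
    HasDerivAt (orbit N α β) (field Ω (orbit N α β t)) t := by
  have hpos : 0 < N - α t ^ 2 - β t ^ 2 := by linarith [hdisc t]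
  have hA : amp N α β t ^ 2 = N - α t ^ 2 - β t ^ 2 := sq_sqrt hpos.le
  have hA0 : 0 < amp N α β t := sqrt_pos.2 hpos
  rw [hasDerivAt_pi]
  intro i
  fin_cases i
  · refine (h.deriv_α t).congr_deriv ?_
    simp [field, orbit]; ring
  · refine (h.deriv_β t).congr_deriv ?_
    simp [field, orbit, hA]; ring
  -- Strict inclusion in the disc keeps the square root away from its singular point and allows
  -- division by `A`.
  · have hd := ((((h.deriv_α t).pow 2).const_sub N).sub ((h.deriv_β t).pow 2)).sqrt
      (by simpa using hpos.ne')
    refine hd.congr_deriv ?_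
    have e : √((N - (α ^ 2) t) - (β ^ 2) t) = amp N α β t := rfl
    simp only [field, orbit, Pi.sub_apply, e]
    rw [div_eq_iff (by positivity)]
    simp
    linear_combination (4 * α t * β t) * hA

section Phase

variable {n s a : ℝ} {φ : ℝ → ℝ}

/-- The solution of the planar system that corresponds to the phase `φ`. -/
theorem isPlanarSolution_of_phase (hn : 0 < n) (hP : 0 < a ^ 2 + s)
    (hφ : ∀ t, HasDerivAt φ
      (2 * √(a ^ 2 + s + a ^ 2 * cos (φ t) ^ 2) * √(n + a ^ 2 * cos (φ t) ^ 2)) t) :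
    IsPlanarSolution (2 * n) (n - s) (fun t => a * cos (φ t))
      (fun t => -(a * sin (φ t)) *
        (√(a ^ 2 + s + a ^ 2 * cos (φ t) ^ 2) / √(n + a ^ 2 * cos (φ t) ^ 2))) := by
  have key : ∀ t, 0 < a ^ 2 + s + a ^ 2 * cos (φ t) ^ 2 ∧ 0 < n + a ^ 2 * cos (φ t) ^ 2 :=
    fun t => ⟨by positivity, by positivity⟩
  constructor
  · intro t
    obtain ⟨hp, hq⟩ := key t
    refine ((hφ t).cos.const_mul a).congr_deriv ?_
    have hq' := sqrt_pos.2 hq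
    have hq2 := sq_sqrt hq.le
    set q := √(n + a ^ 2 * cos (φ t) ^ 2)
    field_simp
    linear_combination (-(a * sin (φ t))) * hq2
  · intro t
    obtain ⟨hp, hq⟩ := key t
    have h1 := (((hφ t).cos.pow 2).const_mul (a ^ 2)).const_add (a ^ 2 + s)
    have h2 := (((hφ t).cos.pow 2).const_mul (a ^ 2)).const_add n
    have h := ((hφ t).sin.const_mul a).neg.mul
      ((h1.sqrt (by simpa using hp.ne')).div (h2.sqrt (by simpa using hq.ne'))
        (by simpa using (sqrt_pos.2 hq).ne'))
    refine (h.congr_deriv ?_)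
    have hp' := sqrt_pos.2 hp
    have hq' := sqrt_pos.2 hq
    have hp2 := sq_sqrt hp.le
    have hsc := sin_sq_add_cos_sq (φ t)
    simp
    set p := √(a ^ 2 + s + a ^ 2 * cos (φ t) ^ 2)
    set q := √(n + a ^ 2 * cos (φ t) ^ 2)
    field_simp
    linear_combination (2 * a * cos (φ t) * q ^ 2) * (a ^ 2 * hsc - hp2)

/-- The Hamiltonian along the solution that corresponds to a phase. -/
theorem hamDW_phase (hn : 0 < n) (hP : 0 < a ^ 2 + s) (x : ℝ) :
    hamDW (2 * n) (n - s) (a * cos x) (-(a * sin x) *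
        (√(a ^ 2 + s + a ^ 2 * cos x ^ 2) / √(n + a ^ 2 * cos x ^ 2)))
      = a ^ 2 * (a ^ 2 + s) := by
  have hp : 0 < a ^ 2 + s + a ^ 2 * cos x ^ 2 := by positivity
  have hq : 0 < n + a ^ 2 * cos x ^ 2 := by positivity
  have hsc := sin_sq_add_cos_sq x
  simp only [hamDW, mul_pow, div_pow, neg_sq, sq_sqrt hp.le, sq_sqrt hq.le]
  field_simp
  rw [show sin x ^ 2 = 1 - cos x ^ 2 by linarith]
  ring

end Phase

/-- The constant `c` measures the distance from the separatrix, and `μ √n` is the frequency scale of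
the orbit. -/
theorem exists_periodic_orbit {n s a c μ : ℝ} (hn : 0 < n) (ha : 0 < a) (hc : 0 < c)
    (hμ : 0 < μ) (hμs : |s| + a ^ 2 = μ ^ 2) (hcs : c * μ ^ 2 ≤ a ^ 2 + s)
    (hsmall : 4 * μ ^ 2 ≤ n) :
    ∃ (α β : ℝ → ℝ) (T : ℝ), IsPeriodicOrbit (2 * n) (n - s) a α β T ∧
      (∀ t, hamDW (2 * n) (n - s) (α t) (β t) = a ^ 2 * (a ^ 2 + s)) ∧
      T ≤ π / (√c * √n * μ) ∧
      ∀ t, α t ^ 2 ≤ a ^ 2 ∧ β t ^ 2 ≤ 2 * a ^ 2 * μ ^ 2 / n := by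
  have hP : 0 < a ^ 2 + s := lt_of_lt_of_le (by positivity) hcs
  obtain ⟨φ, T, hφ0, hmono, hsurj, hφ, hT, hTle, hper⟩ := exists_phase
    (F := fun x => 2 * √(a ^ 2 + s + a ^ 2 * cos x ^ 2) * √(n + a ^ 2 * cos x ^ 2))
    (m := 2 * (√c * √n * μ)) (p := 2 * π)
    (by fun_prop) (by positivity) (by positivity)
    -- The slowest phase is `cos x = 0`, where `α = 0`; both radicands are bounded below by dropping
    -- `cos²`.
    (fun x => by
      have h1 : √c * μ ≤ √(a ^ 2 + s + a ^ 2 * cos x ^ 2) := by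
        rw [← sqrt_sq hμ.le, ← sqrt_mul hc.le]
        exact sqrt_le_sqrt (by nlinarith [sq_nonneg (a * cos x)])
      have h2 : √n ≤ √(n + a ^ 2 * cos x ^ 2) :=
        sqrt_le_sqrt (by nlinarith [sq_nonneg (a * cos x)])
      have := mul_le_mul h1 h2 (sqrt_nonneg _) (sqrt_nonneg _)
      linarith)
    (fun x => by simp)
  set R : ℝ → ℝ := fun x => √(a ^ 2 + s + a ^ 2 * cos x ^ 2) / √(n + a ^ 2 * cos x ^ 2) with hR
  have hRper : ∀ x, R (x + 2 * π) = R x := fun x => by simp [hR]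
  have hsol := isPlanarSolution_of_phase hn hP hφ
  have hbound : ∀ t, (a * cos (φ t)) ^ 2 ≤ a ^ 2 ∧
      (-(a * sin (φ t)) * R (φ t)) ^ 2 ≤ 2 * a ^ 2 * μ ^ 2 / n := fun t => by
    have hc1 := cos_sq_le_one (φ t)
    have hs1 := sin_sq_le_one (φ t)
    have hp : 0 < a ^ 2 + s + a ^ 2 * cos (φ t) ^ 2 := by positivity
    have hq : 0 < n + a ^ 2 * cos (φ t) ^ 2 := by positivity
    refine ⟨by rw [mul_pow]; exact mul_le_of_le_one_right (by positivity) hc1, ?_⟩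
    simp only [hR, mul_pow, div_pow, neg_sq, sq_sqrt hp.le, sq_sqrt hq.le]
    have h1 : (a ^ 2 + s + a ^ 2 * cos (φ t) ^ 2) / (n + a ^ 2 * cos (φ t) ^ 2)
        ≤ 2 * μ ^ 2 / n :=
      div_le_div₀ (by positivity) (by nlinarith [le_abs_self s, abs_nonneg s]) hn
        (by nlinarith [sq_nonneg (a * cos (φ t))])
    calc _ ≤ a ^ 2 * 1 * (2 * μ ^ 2 / n) := by gcongr
      _ = _ := by ring
  have hdisc : ∀ t, (a * cos (φ t)) ^ 2 + (-(a * sin (φ t)) * R (φ t)) ^ 2 < n - s := fun t => by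
    obtain ⟨h1, h2⟩ := hbound t
    have h3 : 2 * a ^ 2 * μ ^ 2 / n ≤ a ^ 2 := by
      rw [div_le_iff₀ hn]; nlinarith [sq_pos_of_pos ha]
    nlinarith [le_abs_self s, abs_nonneg s, sq_pos_of_pos ha]
  have hperiodic : Function.Periodic
      (fun t => (a * cos (φ t), -(a * sin (φ t)) * R (φ t))) T := fun t => by
    simp only [hper, hRper, cos_add_two_pi, sin_add_two_pi]
  refine ⟨fun t => a * cos (φ t), fun t => -(a * sin (φ t)) * R (φ t), T,
    ⟨hsol, ?_, ?_, ⟨⟨hT, hperiodic⟩, ?_⟩, hdisc, ⟨⟨0, ?_⟩, ?_⟩, hsol.hasDerivAt_orbit hdisc, ?_⟩,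
    fun t => hamDW_phase hn hP _, ?_, hbound⟩
  · simp [hφ0]
  · simp [hφ0]
  · rintro S ⟨hS, hSper⟩
    have h1 : a * cos (φ S) = a := by
      have := congrArg Prod.fst (hSper 0)
      simpa [hφ0] using this
    have h2 : cos (φ S) = 1 := by
      have := mul_left_cancel₀ ha.ne' (h1.trans (mul_one a).symm)
      exact this
    have h3 : 0 < φ S := hφ0 ▸ hmono hS
    -- A return of `α` to its maximum forces a full turn of the phase, so no period is shorter than
    -- `T`.
    have h4 : 2 * π ≤ φ S := by
      by_contra! hlt
      exact h3.ne' ((cos_eq_one_iff_of_lt_of_lt (by linarith [pi_pos]) hlt).1 h2)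
    have h5 : φ T = 2 * π := by simpa [hφ0] using hper 0
    exact hmono.le_iff_le.1 (h5 ▸ h4)
  · simpa [hφ0] using ha
  · obtain ⟨t, ht⟩ := hsurj π
    exact ⟨t, by simpa [ht] using ha⟩
  · intro t
    have := hperiodic t
    simp only [Prod.mk.injEq] at this
    simp only [amp, this.1, this.2]
  · rwa [mul_div_mul_left _ _ two_ne_zero] at hTle

end DoubleWell

/-! ### The linearized flow in rescaled coordinates. -/

namespace DoubleWell

open Real

/-- The Jacobian matrix at a point of a small orbit, in coordinates in which the orbit has
aspect ratio of order one. -/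
theorem norm_scaled_jac_le {q s a μ : ℝ} {χ : Fin 3 → ℝ} (hq : 0 < q) (hμ : 0 < μ) (ha : 0 < a)
    (hμs : |s| + a ^ 2 = μ ^ 2) (hsmall : 4 * μ ^ 2 ≤ q ^ 2) (h0 : χ 0 ^ 2 ≤ a ^ 2)
    (h1 : χ 1 ^ 2 ≤ 2 * a ^ 2 * μ ^ 2 / q ^ 2) (h2 : χ 2 ^ 2 = q ^ 2 - s - χ 0 ^ 2 - χ 1 ^ 2) :
    ‖Matrix.diagonal ![μ / q, 1, 1] * jac (2 * q ^ 2) χ * Matrix.diagonal ![q / μ, 1, 1]‖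
      ≤ 40 * (q * μ) := by
  have hs0 := abs_nonneg s
  have haμ : a ≤ μ := abs_le_of_sq_le_sq' (by linarith) hμ.le |>.2
  have hμq : 2 * μ ≤ q := abs_le_of_sq_le_sq' (by linarith) hq.le |>.2
  have b0 : |χ 0| ≤ a := abs_le_of_sq_le_sq h0 ha.le
  have b1 : |χ 1| * q ≤ 2 * a * μ := by
    rw [le_div_iff₀ (by positivity)] at h1
    rw [show |χ 1| * q = |χ 1 * q| by rw [abs_mul, abs_of_pos hq]]
    refine abs_le_of_sq_le_sq ?_ (by positivity)
    nlinarith [sq_nonneg (a * μ)]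
  have b2 : |χ 2| ≤ 2 * q := by
    refine abs_le_of_sq_le_sq ?_ (by positivity)
    nlinarith [neg_abs_le s, sq_nonneg (χ 0), sq_nonneg (χ 1)]
  have b1a : |χ 1| ≤ a := by
    have := abs_nonneg (χ 1)
    nlinarith
  have b1s : χ 1 ^ 2 ≤ a ^ 2 := sq_le_sq.2 (by rwa [abs_of_pos ha])
  have p0 := abs_nonneg (χ 0)
  have p1 := abs_nonneg (χ 1)
  have p2 := abs_nonneg (χ 2)
  have b01 : |χ 0| * |χ 1| ≤ q * μ := by
    have := mul_le_mul b0 b1a p1 ha.le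
    nlinarith
  have b02 : |χ 0| * |χ 2| ≤ 2 * (q * μ) := by
    have := mul_le_mul b0 b2 p2 ha.le
    nlinarith
  have b12 : |χ 1| * |χ 2| * q ≤ 4 * (q * μ) * μ := by
    have := mul_le_mul b1 b2 p2 (by positivity)
    nlinarith [mul_pos hq hμ]
  refine (l2_opNorm_le_sum _).trans ?_
  have e01 : |μ / q * (2 * q ^ 2 + 2 * χ 0 ^ 2)| ≤ 4 * (q * μ) := by
    rw [abs_of_nonneg (by positivity), div_mul_eq_mul_div, div_le_iff₀ hq]
    nlinarith [mul_pos hq hμ]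
  have e10 : |-(2 * q ^ 2 + 6 * χ 0 ^ 2 - 2 * χ 2 ^ 2) * (q / μ)| ≤ 10 * (q * μ) := by
    -- The conservation law cancels the large terms `q²`: the entry is `-(2 s + 8 α² + 2 β²) =
    -- O(μ²)`, which absorbs the weight `q / μ`.
    have : |-(2 * q ^ 2 + 6 * χ 0 ^ 2 - 2 * χ 2 ^ 2)| ≤ 10 * μ ^ 2 := by
      rw [h2, abs_le]
      constructor <;> nlinarith [neg_abs_le s, le_abs_self s, sq_nonneg (χ 0), sq_nonneg (χ 1)]
    rw [abs_mul, abs_of_pos (div_pos hq hμ)]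
    calc _ ≤ 10 * μ ^ 2 * (q / μ) := by gcongr
      _ = 10 * (q * μ) := by field_simp
  -- Here the weight `q / μ` is absorbed by the smallness of `β`, through `|β| q ≤ 2 a μ`.
  have e20 : |-2 * χ 1 * χ 2 * (q / μ)| ≤ 8 * (q * μ) := by
    rw [abs_mul, abs_mul, abs_mul, abs_of_pos (div_pos hq hμ), mul_div_assoc', div_le_iff₀ hμ]
    norm_num
    linarith
  have e00 : |μ / q * (4 * χ 0 * χ 1) * (q / μ)| ≤ 4 * (q * μ) := by
    rw [show μ / q * (4 * χ 0 * χ 1) * (q / μ) = 4 * χ 0 * χ 1 by field_simp, abs_mul, abs_mul]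
    norm_num
    linarith
  have e12 : |4 * χ 0 * χ 2| ≤ 8 * (q * μ) := by
    rw [abs_mul, abs_mul]
    norm_num
    linarith
  have e21 : |-2 * χ 0 * χ 2| ≤ 4 * (q * μ) := by
    rw [abs_mul, abs_mul]
    norm_num
    linarith
  have e22 : |-2 * χ 0 * χ 1| ≤ 2 * (q * μ) := by
    rw [abs_mul, abs_mul]
    norm_num
    linarith
  simp only [Matrix.mul_diagonal, Matrix.diagonal_mul, jac, Fin.sum_univ_three, Matrix.of_apply,
    Matrix.cons_val_zero, Matrix.cons_val_one, Matrix.cons_val, mul_zero, abs_zero,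
    one_mul, mul_one]
  -- The entry bounds add up: `4 + 4 + 10 + 8 + 8 + 4 + 2 = 40`.
  linarith

theorem norm_vec3_one_one_le {x b : ℝ} (hx : |x| ≤ b) (hb : 1 ≤ b) : ‖![x, 1, 1]‖ ≤ b := by
  rw [pi_norm_le_iff_of_nonneg (zero_le_one.trans hb)]
  intro i
  fin_cases i <;> simp [hx, hb]

theorem FundamentalBound.mono {Ω N T R R' : ℝ} {α β : ℝ → ℝ} (h : FundamentalBound Ω N α β T R)
    (hR : R ≤ R') : FundamentalBound Ω N α β T R' :=
  ⟨h.1, fun M hM s t hs hs' ht ht' => (h.2 M hM s t hs hs' ht ht').trans hR⟩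

/-- The conjugated propagator equals `1` at the initial time and has growth rate at most `40 q μ`,
so over one period it is bounded by `exp (40 Θ)`. The factor `q / μ` bounds `‖D'‖ ‖D‖`. -/
theorem IsPeriodicOrbit.fundamentalBound {q s a μ T Θ : ℝ} {α β : ℝ → ℝ} (hq : 0 < q)
    (hμ : 0 < μ) (ha : 0 < a) (hμs : |s| + a ^ 2 = μ ^ 2) (hsmall : 4 * μ ^ 2 ≤ q ^ 2)
    (h : IsPeriodicOrbit (2 * q ^ 2) (q ^ 2 - s) a α β T)
    (hb : ∀ t, α t ^ 2 ≤ a ^ 2 ∧ β t ^ 2 ≤ 2 * a ^ 2 * μ ^ 2 / q ^ 2) (hT : q * μ * T ≤ Θ) :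
    FundamentalBound (2 * q ^ 2) (q ^ 2 - s) α β T (exp (40 * Θ) * (q / μ)) := by
  set D : Matrix (Fin 3) (Fin 3) ℝ := Matrix.diagonal ![μ / q, 1, 1] with hD
  set D' : Matrix (Fin 3) (Fin 3) ℝ := Matrix.diagonal ![q / μ, 1, 1] with hD'
  set B : ℝ → Matrix (Fin 3) (Fin 3) ℝ :=
    fun t => jac (2 * q ^ 2) (orbit (q ^ 2 - s) α β t) with hB
  have hμq : 2 * μ ≤ q := abs_le_of_sq_le_sq' (by linarith) hq.le |>.2
  have hDD' : D * D' = 1 := by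
    rw [hD, hD', Matrix.diagonal_mul_diagonal, ← Matrix.diagonal_one]
    congr 1
    ext i
    fin_cases i <;> simp [hq.ne', hμ.ne']
  have hD'D : D' * D = 1 := mul_eq_one_comm.1 hDD'
  have nD : ‖D‖ ≤ 1 := by
    rw [hD, Matrix.l2_opNorm_diagonal]
    refine norm_vec3_one_one_le ?_ le_rfl
    rw [abs_of_pos (by positivity), div_le_one hq]
    linarith
  have nD' : ‖D'‖ ≤ q / μ := by
    rw [hD', Matrix.l2_opNorm_diagonal]
    refine norm_vec3_one_one_le (abs_of_pos (by positivity)).le ?_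
    rw [one_le_div hμ]
    linarith
  have conj_bound : ∀ X Y : Matrix (Fin 3) (Fin 3) ℝ, ∀ b, D * X * D' = Y → ‖Y‖ ≤ b →
      ‖X‖ ≤ b * (q / μ) := fun X Y b e hY => by
    have : X = D' * Y * D := by
      rw [← e]
      simp only [← Matrix.mul_assoc, hD'D, Matrix.one_mul]
      rw [Matrix.mul_assoc, hD'D, Matrix.mul_one]
    rw [this]
    calc ‖D' * Y * D‖ ≤ ‖D'‖ * ‖Y‖ * ‖D‖ :=
          (norm_mul_le _ _).trans (mul_le_mul_of_nonneg_right (norm_mul_le _ _) (norm_nonneg _))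
      _ ≤ q / μ * b * 1 := by
          have : 0 ≤ b := (norm_nonneg _).trans hY
          gcongr
      _ = b * (q / μ) := by ring
  have hDB : ∀ t, ‖D * B t * D'‖ ≤ 40 * (q * μ) := fun t =>
    norm_scaled_jac_le hq hμ ha hμs hsmall (hb t).1 (hb t).2
      (sq_sqrt (by linarith [h.in_disc t]))
  have hBc : Continuous B := by
    have ho : Continuous (orbit (q ^ 2 - s) α β) :=
      continuous_iff_continuousAt.2 fun t => (h.solution_field t).continuousAt
    have ho' : ∀ i, Continuous fun t => orbit (q ^ 2 - s) α β t i := fun i =>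
      (continuous_apply i).comp ho
    refine continuous_matrix fun i j => ?_
    have c0 := ho' 0
    have c1 := ho' 1
    have c2 := ho' 2
    fin_cases i <;> fin_cases j <;> simp [hB, jac] <;> fun_prop
  constructor
  · obtain ⟨M, hM0, hM, hdet⟩ := exists_fundamental_matrix hBc
      (fun t => conj_bound (B t) _ _ rfl (hDB t))
    exact ⟨M, ⟨fun t => hasDerivAt_matrix_iff.1 (hM t), hdet⟩, hM0⟩
  · intro M hM x t hx hxT ht htT
    have hMd : ∀ y, HasDerivAt M (B y * M y) y := fun y => hasDerivAt_matrix_iff.2 (hM.deriv y)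
    have hX : ∀ y, HasDerivAt (fun y => D * (M y * (M x)⁻¹) * D')
        ((D * B y * D') * (D * (M y * (M x)⁻¹) * D')) y := fun y => by
      refine ((((hMd y).mul_const _).const_mul D).mul_const D').congr_deriv ?_
      -- The factor `1` is a place for `D' * D` between `B` and `M`.
      calc _ = D * B y * 1 * M y * (M x)⁻¹ * D' := by simp only [Matrix.mul_assoc, Matrix.one_mul]
        _ = _ := by rw [← hD'D]; simp only [Matrix.mul_assoc]
    have hg := norm_le_exp x t hX hDB
    have hx1 : D * (M x * (M x)⁻¹) * D' = 1 := by
      rw [Matrix.mul_nonsing_inv _ (hM.invertible x), Matrix.mul_one, hDD']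
    rw [hx1, norm_one, one_mul] at hg
    refine conj_bound _ _ _ rfl (hg.trans (exp_le_exp.2 ?_))
    have : |t - x| ≤ T := abs_le.2 ⟨by linarith, by linarith⟩
    have := mul_le_mul_of_nonneg_left this (mul_pos hq hμ).le
    linarith

/-- The frequency scale `√(|s| n)` of the linearization at the origin bounds the period, and the
aspect ratio `√(n / |s|)` bounds the fundamental matrices. -/
theorem exists_orbit_with_bounds {n s a c : ℝ} (hn : 0 < n) (ha : 0 < a) (hc : 0 < c) (hs : s ≠ 0)
    (hcs : c * (|s| + a ^ 2) ≤ a ^ 2 + s) (hsmall : 4 * (|s| + a ^ 2) ≤ n) :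
    ∃ (α β : ℝ → ℝ) (T : ℝ), IsPeriodicOrbit (2 * n) (n - s) a α β T ∧
      (∀ t, hamDW (2 * n) (n - s) (α t) (β t) = a ^ 2 * (a ^ 2 + s)) ∧
      (∀ t, amp (n - s) α β t ^ 2 ≤ 2 * n) ∧ (∀ t, α t ^ 2 + β t ^ 2 ≤ 2 * a ^ 2) ∧
      T ≤ π / √c * (|s| * n) ^ (-(1 / 2) : ℝ) ∧
      FundamentalBound (2 * n) (n - s) α β T (exp (40 * (π / √c)) * (n / |s|) ^ (1 / 2 : ℝ)) := by
  have hs' : 0 < |s| := abs_pos.2 hs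
  obtain ⟨q, hq, rfl⟩ : ∃ q, 0 < q ∧ n = q ^ 2 := ⟨√n, sqrt_pos.2 hn, (sq_sqrt hn.le).symm⟩
  obtain ⟨μ, hμ, hμs⟩ : ∃ μ, 0 < μ ∧ |s| + a ^ 2 = μ ^ 2 :=
    ⟨√(|s| + a ^ 2), sqrt_pos.2 (by positivity), (sq_sqrt (by positivity)).symm⟩
  rw [hμs] at hcs hsmall
  obtain ⟨α, β, T, horb, hham, hT, hb⟩ := exists_periodic_orbit hn ha hc hμ hμs hcs hsmall
  rw [sqrt_sq hq.le] at hT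
  have hsc := sqrt_pos.2 hc
  have hTμ : q * μ * T ≤ π / √c := by
    calc q * μ * T ≤ q * μ * (π / (√c * q * μ)) := by gcongr
      _ = π / √c := by field_simp
  -- Replacing `μ` by the smaller `√|s|` removes the amplitude from both bounds.
  have hsμ : √|s| ≤ μ := by
    rw [sqrt_le_left hμ.le]; nlinarith
  have hβa : ∀ t, β t ^ 2 ≤ a ^ 2 := fun t => (hb t).2.trans (by
    rw [div_le_iff₀ hn]; nlinarith [sq_pos_of_pos ha])
  refine ⟨α, β, T, horb, hham, fun t => ?_, fun t => by linarith [(hb t).1, hβa t], ?_, ?_⟩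
  · rw [amp, sq_sqrt (by linarith [horb.in_disc t])]
    nlinarith [neg_abs_le s, sq_nonneg (α t), sq_nonneg (β t)]
  · rw [rpow_neg (by positivity), ← sqrt_eq_rpow, sqrt_mul hs'.le, sqrt_sq hq.le]
    refine hT.trans ?_
    rw [← div_eq_mul_inv, div_div, mul_assoc (√c), mul_comm q]
    have := sqrt_pos.2 hs'
    gcongr
  · refine (horb.fundamentalBound hq hμ ha hμs hsmall hb hTμ).mono ?_
    rw [← sqrt_eq_rpow, sqrt_div (by positivity), sqrt_sq hq.le]
    have := sqrt_pos.2 hs'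
    gcongr

/-- If `|s| ≥ c₀ σ`, then `|s| n ≥ c₀ σ^(1+γ)` and `n / |s| ≤ c₀⁻¹ σ^(γ-1)`; the square roots
produce the factor `c₀^(-1/2)`. -/
theorem periodAndMatrixBounds_of_le {P E C c₀ γ σ n s T : ℝ} {α β : ℝ → ℝ} (hP : 0 < P)
    (hE : 0 < E) (hc₀ : 0 < c₀) (hσ : 0 < σ) (hn : n = σ ^ γ) (hs : s ≠ 0) (hsn : |s| ≤ n)
    (hPC : P ≤ C) (hEC : E ≤ C) (hPC' : P * c₀ ^ (-(1 / 2) : ℝ) ≤ C)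
    (hEC' : E * c₀ ^ (-(1 / 2) : ℝ) ≤ C)
    (hT : T ≤ P * (|s| * n) ^ (-(1 / 2) : ℝ))
    (hM : FundamentalBound (2 * n) (n - s) α β T (E * (n / |s|) ^ (1 / 2 : ℝ))) :
    PeriodAndMatrixBounds C c₀ γ σ (2 * n) (n - s) α β T := by
  have hs' : 0 < |s| := abs_pos.2 hs
  have hn0 : 0 < n := hn ▸ rpow_pos_of_pos hσ γ
  have hN : Ncr (2 * n) = n := by simp [Ncr]
  have e1 : |n - (n - s)| = |s| := by rw [sub_sub_cancel]
  have e2 : |n - s - n| = |s| := by rw [sub_sub_cancel_left, abs_neg]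
  constructor
  · rw [hN, e1]
    exact hT.trans (by gcongr)
  · rw [hN, e2]
    have hC : 0 ≤ C := hE.le.trans hEC
    refine hM.mono ?_
    -- `N = n - s ≥ 0`, so `n ≤ N + N_cr`.
    have : n ≤ n - s + n := by linarith [le_abs_self s]
    gcongr
  · rw [hN, e2]
    intro h
    calc T ≤ P * (|s| * n) ^ (-(1 / 2) : ℝ) := hT
      _ ≤ P * (c₀ * σ * n) ^ (-(1 / 2) : ℝ) := by
          refine mul_le_mul_of_nonneg_left
            (rpow_le_rpow_of_nonpos (by positivity) (by gcongr) (by norm_num)) hP.le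
      _ = P * c₀ ^ (-(1 / 2) : ℝ) * σ ^ (-((1 + γ) / 2)) := by
          rw [mul_assoc c₀, mul_rpow hc₀.le (by positivity), hn,
            show σ * σ ^ γ = σ ^ (1 + γ) by rw [rpow_add hσ, rpow_one], ← rpow_mul hσ.le]
          ring_nf
      _ ≤ _ := by gcongr
  · rw [hN, e2]
    intro h
    refine hM.mono ?_
    calc E * (n / |s|) ^ (1 / 2 : ℝ) ≤ E * (n / (c₀ * σ)) ^ (1 / 2 : ℝ) := by gcongr
      _ = E * c₀ ^ (-(1 / 2) : ℝ) * σ ^ ((γ - 1) / 2) := by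
          rw [show n / (c₀ * σ) = c₀⁻¹ * σ ^ (γ - 1) by
            rw [hn, rpow_sub_one hσ.ne']; field_simp, mul_rpow (by positivity) (by positivity),
            ← rpow_mul hσ.le, inv_rpow hc₀.le, rpow_neg hc₀.le]
          ring_nf
      _ ≤ _ := by gcongr

end DoubleWell

/-! ### Choice of constants and the two regimes. -/

theorem lemma2p2 (κ K c₀ : ℝ) (hκ : 1 < κ) (hK : 0 < K) (hc₀ : 0 < c₀) :
    ∃ C : ℝ, 0 < C ∧ ∀ γ : ℝ, 7 / 9 < γ → γ < 1 →
      ∃ σ₀ : ℝ, 0 < σ₀ ∧ ∀ σ : ℝ, 0 < σ → σ < σ₀ →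
        ∀ Ω N : ℝ, DoubleWell.Ncr Ω = σ ^ γ → |N - DoubleWell.Ncr Ω| ≤ σ →
          -- Josephson tunneling orbits, outside the separatrix and away from it
          (DoubleWell.Ncr Ω < N → ∀ α₀ : ℝ, 0 < α₀ →
            κ * (N - DoubleWell.Ncr Ω) ≤ α₀ ^ 2 → α₀ ^ 2 ≤ K * σ →
            ∃ (α β : ℝ → ℝ) (T : ℝ),
              DoubleWell.IsPeriodicOrbit Ω N α₀ α β T ∧
              (∀ t, 0 < DoubleWell.hamDW Ω N (α t) (β t)) ∧
              (∀ t, DoubleWell.amp N α β t ^ 2 ≤ C * σ ^ γ) ∧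
              (∀ t, α t ^ 2 + β t ^ 2 ≤ C * σ) ∧
              DoubleWell.PeriodAndMatrixBounds C c₀ γ σ Ω N α β T) ∧
          -- beating orbits
          (N < DoubleWell.Ncr Ω → ∀ δ : ℝ, 0 ≤ δ → ∀ α₀ : ℝ, 0 < α₀ →
            α₀ ^ 2 ≤ K * σ ^ (1 + δ) →
            ∃ (α β : ℝ → ℝ) (T : ℝ),
              DoubleWell.IsPeriodicOrbit Ω N α₀ α β T ∧
              (∀ t, DoubleWell.amp N α β t ^ 2 ≤ C * σ ^ γ) ∧
              (∀ t, α t ^ 2 + β t ^ 2 ≤ C * σ ^ (1 + δ)) ∧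
              DoubleWell.PeriodAndMatrixBounds C c₀ γ σ Ω N α β T) := by
  -- For `s < 0`, the inequality `a² - |s| ≥ c (a² + |s|)` with this `c` is equivalent to `a² ≥ κ
  -- |s|`.
  have hc : 0 < (κ - 1) / (κ + 1) := div_pos (by linarith) (by linarith)
  set c := (κ - 1) / (κ + 1) with hc_def
  have hc1 : c ≤ 1 := (div_le_one (by linarith)).2 (by linarith)
  have hP : 0 < Real.pi / √c := by positivity
  set P := Real.pi / √c
  have hE := Real.exp_pos (40 * P)
  set E := Real.exp (40 * P)
  have hG : 0 < c₀ ^ (-(1 / 2) : ℝ) := by positivity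
  set G := c₀ ^ (-(1 / 2) : ℝ) with hG_def
  have hPG := mul_pos hP hG
  have hEG := mul_pos hE hG
  -- The summands serve, in order, `A² ≤ 2 n`, `α² + β² ≤ 2 a²`, the period, the matrix, and the
  -- last two in powers of `σ`.
  refine ⟨2 + 2 * K + P + E + P * G + E * G, by positivity, fun γ _ hγ => ?_⟩
  -- This threshold makes `4 (1 + K) σ ≤ σ^γ = n`, hence `4 (|s| + a²) ≤ n`; it is also below `1`,
  -- so that `σ^(1+δ) ≤ σ`.
  refine ⟨(4 * (1 + K)) ^ (-(1 / (1 - γ))), by positivity, fun σ hσ hσ₀ Ω N hΩ hNσ => ?_⟩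
  have hγ' : 0 < 1 - γ := by linarith
  have hσ1 : σ < 1 := hσ₀.trans (Real.rpow_lt_one_of_one_lt_of_neg (by linarith)
    (neg_neg_of_pos (by positivity)))
  have hsmall : 4 * (1 + K) * σ ≤ σ ^ γ := by
    have h1 : σ ^ (1 - γ) ≤ (4 * (1 + K))⁻¹ := by
      have := Real.rpow_le_rpow hσ.le hσ₀.le hγ'.le
      rwa [← Real.rpow_mul (by positivity), neg_mul, one_div_mul_cancel hγ'.ne',
        Real.rpow_neg_one] at this
    have h2 : σ = σ ^ γ * σ ^ (1 - γ) := by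
      rw [← Real.rpow_add hσ, add_sub_cancel, Real.rpow_one]
    calc 4 * (1 + K) * σ = 4 * (1 + K) * (σ ^ γ * σ ^ (1 - γ)) := by rw [← h2]
      _ ≤ 4 * (1 + K) * (σ ^ γ * (4 * (1 + K))⁻¹) := by gcongr
      _ = σ ^ γ := by field_simp
  obtain ⟨n, rfl⟩ : ∃ n, Ω = 2 * n := ⟨Ω / 2, by ring⟩
  obtain ⟨s, rfl⟩ : ∃ s, N = n - s := ⟨n - N, by ring⟩
  have hN : DoubleWell.Ncr (2 * n) = n := by simp [DoubleWell.Ncr]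
  rw [hN] at hΩ hNσ ⊢
  rw [sub_sub_cancel_left, abs_neg] at hNσ
  have hn : 0 < n := hΩ ▸ Real.rpow_pos_of_pos hσ γ
  rw [← hΩ] at hsmall
  have hKσ := mul_pos hK hσ
  have hsn : |s| ≤ n := by linarith
  constructor
  · intro hs a ha h1 h2
    have hs0 : s < 0 := by linarith
    have hcs : c * (|s| + a ^ 2) ≤ a ^ 2 + s := by
      rw [abs_of_neg hs0, hc_def, div_mul_eq_mul_div, div_le_iff₀ (by linarith)]
      linarith
    obtain ⟨α, β, T, horb, hham, hamp, hsq, hT, hM⟩ :=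
      DoubleWell.exists_orbit_with_bounds hn ha hc hs0.ne hcs (by linarith)
    refine ⟨α, β, T, horb, fun t => ?_, fun t => (hamp t).trans ?_, fun t => (hsq t).trans ?_,
      DoubleWell.periodAndMatrixBounds_of_le hP hE hc₀ hσ hΩ hs0.ne hsn (by linarith)
        (by linarith) (by linarith) (by linarith) hT hM⟩
    · rw [hham]
      exact mul_pos (by positivity) (lt_of_lt_of_le (by positivity) hcs)
    · rw [← hΩ]
      gcongr
      linarith
    · calc 2 * a ^ 2 ≤ 2 * K * σ := by linarith
        _ ≤ _ := by gcongr; linarith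
  · intro hs δ hδ a ha h2
    have hs0 : 0 < s := by linarith
    -- For `s > 0` there is no separatrix: `a² + s = |s| + a²`, and `c ≤ 1` suffices.
    have hcs : c * (|s| + a ^ 2) ≤ a ^ 2 + s := by
      rw [abs_of_pos hs0]
      exact (mul_le_of_le_one_left (by positivity) hc1).trans (by linarith)
    have hσδ : K * σ ^ (1 + δ) ≤ K * σ := by
      gcongr
      exact (Real.rpow_le_rpow_of_exponent_ge hσ hσ1.le (by linarith : 1 ≤ 1 + δ)).trans
        (Real.rpow_one σ).le
    obtain ⟨α, β, T, horb, hham, hamp, hsq, hT, hM⟩ :=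
      DoubleWell.exists_orbit_with_bounds hn ha hc hs0.ne' hcs (by linarith)
    refine ⟨α, β, T, horb, fun t => (hamp t).trans ?_, fun t => (hsq t).trans ?_,
      DoubleWell.periodAndMatrixBounds_of_le hP hE hc₀ hσ hΩ hs0.ne' hsn (by linarith)
        (by linarith) (by linarith) (by linarith) hT hM⟩
    · rw [← hΩ]
      gcongr
      linarith
    · calc 2 * a ^ 2 ≤ 2 * K * σ ^ (1 + δ) := by linarith
        _ ≤ _ := by gcongr; linarith
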